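/- Let $G$ be a finite directed acyclic graph (DAG), let $\mathbf W$ be a set of vertices (variables) of $G$, designated as functional, and let $\mathbf W'\subseteq\mathbf W$. Functionally eliminating a variable $T$ from a DAG means adding an edge from each parent of $T$ to each child of $T$ and then removing $T$. Let $G'$ be the DAG obtained from $G$ by functionally eliminating the variables of $\mathbf W'$ one after the other, in any order. For a DAG $H$ and a set $\mathbf S$ of its vertices, a path (without repeated vertices) in the underlying undirected graph of $H$ is blocked by $\mathbf S$ if it contains an interior vertex at which its two edges meet head to head (a collider) such that neither this vertex nor any of its descendants in $H$ belongs to $\mathbf S$, or if it contains a vertex that is not a collider on the path and belongs to $\mathbf S$; the end points of the path count as non-colliders. Sets $\mathbf X$ and $\mathbf Y$ are d-separated by $\mathbf S$ in $H$ if every path between a vertex of $\mathbf X$ and a vertex of $\mathbf Y$ is blocked by $\mathbf S$. For a set $\mathbf U$ of vertices of $H$ designated as functional and pairwise disjoint vertex sets $\mathbf X,\mathbf Y,\mathbf Z$, the sets $\mathbf X$ and $\mathbf Y$ are D-separated by $\mathbf Z$ in $\langle H,\mathbf U\rangle$ if they are d-separated in $H$ by the set $\mathbf Z'$ obtained by starting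 with $\mathbf Z'=\mathbf Z$ and repeatedly adding every variable of $\mathbf U$ all of whose parents are in $\mathbf Z'$, until $\mathbf Z'$ stops changing. **Theorem.** For all pairwise disjoint sets $\mathbf X,\mathbf Y,\mathbf Z$ of vertices of $G'$, the sets $\mathbf X$ and $\mathbf Y$ are D-separated by $\mathbf Z$ in $\langle G,\mathbf W\rangle$ if and only if they are D-separated by $\mathbf Z$ in $\langle G',\mathbf W\setminus\mathbf W'\rangle$. -/

import Mathlib

/-- A finite directed acyclic graph whose vertices (variables) form a finite set `verts` of a
type `V` of variable names; `G.Adj a b` is the edge `a → b`. -/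
structure FinDAG (V : Type*) extends Digraph V where
  verts : Set V
  finite_verts : verts.Finite
  left_mem : ∀ {a b : V}, Adj a b → a ∈ verts
  right_mem : ∀ {a b : V}, Adj a b → b ∈ verts
  acyclic : ∀ a : V, ¬ Relation.TransGen Adj a a

namespace FinDAG

/-- Functional elimination of the single variable `x`: add an edge from each parent of `x` to
each child of `x`, then remove `x` (with all edges at `x`). -/
def elim {V : Type*} (G : FinDAG V) (x : V) : FinDAG V where
  Adj a b := a ≠ x ∧ b ≠ x ∧ (G.Adj a b ∨ (G.Adj a x ∧ G.Adj x b))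
  verts := G.verts \ {x}
  finite_verts := G.finite_verts.sdiff
  left_mem := by
    rintro a b ⟨ha, -, h | h⟩
    · exact ⟨G.left_mem h, ha⟩
    · exact ⟨G.left_mem h.1, ha⟩
  right_mem := by
    rintro a b ⟨-, hb, h | h⟩
    · exact ⟨G.right_mem h, hb⟩
    · exact ⟨G.right_mem h.2, hb⟩
  acyclic := by
    have key : ∀ a b : V, Relation.TransGen
        (fun a b => a ≠ x ∧ b ≠ x ∧ (G.Adj a b ∨ (G.Adj a x ∧ G.Adj x b))) a b →
        Relation.TransGen G.Adj a b := by
      have step : ∀ a b : V, (a ≠ x ∧ b ≠ x ∧ (G.Adj a b ∨ (G.Adj a x ∧ G.Adj x b))) →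
          Relation.TransGen G.Adj a b := by
        rintro a b ⟨-, -, h | h⟩
        · exact .single h
        · exact (Relation.TransGen.single h.1).tail h.2
      intro a b h
      induction h with
      | single h => exact step _ _ h
      | tail _ h ih => exact ih.trans (step _ _ h)
    exact fun a h => G.acyclic a (key a a h)

/-- Functional elimination of the variables in the list `l`, one after the other. -/
def elimList {V : Type*} (G : FinDAG V) (l : List V) : FinDAG V :=
  l.foldl elim G

/-- The underlying undirected graph of a DAG. -/
def skeleton {V : Type*} (G : FinDAG V) : SimpleGraph V where
  Adj a b := G.Adj a b ∨ G.Adj b a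
  symm := ⟨fun _ _ h => h.symm⟩
  loopless := ⟨fun a h => G.acyclic a (.single (h.elim id id))⟩

/-- `d` is `a` itself or a descendant of `a`. -/
def IsDescendantOrSelf {V : Type*} (G : FinDAG V) (a d : V) : Prop :=
  Relation.ReflTransGen G.Adj a d

/-- The `i`-th vertex of the path is an interior vertex of the path at which the two path edges
meet head to head (a convergent valve). -/
def IsCollider {V : Type*} (G : FinDAG V) {x y : V} (p : G.skeleton.Walk x y) (i : ℕ) : Prop :=
  0 < i ∧ i < p.length ∧
    G.Adj (p.getVert (i - 1)) (p.getVert i) ∧ G.Adj (p.getVert (i + 1)) (p.getVert i)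

/-- A path is blocked by `Z` if it has a collider that is outside `Z` together with all its
descendants, or a vertex that is not a collider on the path and lies in `Z`. The end points of the
path count as non-colliders; they matter only when `Z` meets the separated sets, which can happen
when `Z` is a closure as in `IsDSepFunctional`. -/
def IsBlocked {V : Type*} (G : FinDAG V) (Z : Set V) {x y : V} (p : G.skeleton.Walk x y) : Prop :=
  ∃ i ≤ p.length,
    (G.IsCollider p i ∧ ∀ d, G.IsDescendantOrSelf (p.getVert i) d → d ∉ Z) ∨
    (¬ G.IsCollider p i ∧ p.getVert i ∈ Z)

/-- Lowercase d-separation of `X` and `Y` by `Z` in `G`: every path between a vertex of `X` and a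
vertex of `Y` is blocked by `Z`. -/
def IsdSep {V : Type*} (G : FinDAG V) (X Y Z : Set V) : Prop :=
  ∀ x ∈ X, ∀ y ∈ Y, ∀ p : G.skeleton.Walk x y, p.IsPath → G.IsBlocked Z p

/-- The closure of `Z` under repeatedly adding every variable of `W` all of whose parents have
already been added. -/
inductive FunClosure {V : Type*} (G : FinDAG V) (W Z : Set V) : V → Prop
  | base {v : V} (hv : v ∈ Z) : FunClosure G W Z v
  | step {w : V} (hw : w ∈ W) (hp : ∀ u, G.Adj u w → FunClosure G W Z u) : FunClosure G W Z w

/-- Uppercase D-separation of `X` and `Y` by `Z` in `⟨G, W⟩`, where `W` is the set of variables of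
`G` designated as functional. -/
def IsDSepFunctional {V : Type*} (G : FinDAG V) (W X Y Z : Set V) : Prop :=
  G.IsdSep X Y {v | G.FunClosure W Z v}

end FinDAG

namespace FinDAG

variable {V : Type*}

/-! It suffices to eliminate one functional variable `w` outside `X`, `Y` and `Z`. Let `C` be the
closure of `Z`. Since `w` is functional and not in `Z`, it lies in `C` exactly when all its parents
do, and eliminating `w` turns the closure into `C \ {w}` (`funClosure_elim`). It remains to compare
d-separation by `C` and by `C \ {w}` (`isdSep_elim_iff`).

Blocked paths are awkward to transform, because rerouting may repeat vertices. Loops can be cut out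
of an active walk, so separation is the absence of active walks (`isdSep_iff`), and these are
rerouted edge by edge.

If `w ∈ C`, no active walk can pass through `w`: its parents are in `C` and block every entry from
above, and a walk entering from a child stops there. The new edges add only dead ends at parents of
`w`. If `w ∉ C`, some parent `p` of `w` is outside `C`. A chain through `w` becomes a new edge, a
fork `c ← w → c'` becomes `c ← p → c'`, and an open collider at `w` moves down to a child of `w`.
The fork is where functionality is essential: without such a `p` it could not be replaced. -/

/-- Reachability along active walks from `x`. The flag records whether the last edge points into
the current vertex. -/
inductive Reach (G : FinDAG V) (C : Set V) (x : V) : V → Bool → Prop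
  | start : Reach G C x x false
  | down {v b : V} {d : Bool} (h : Reach G C x v d) (hv : v ∉ C) (hb : G.Adj v b) :
      Reach G C x b true
  | up {v b : V} (h : Reach G C x v false) (hv : v ∉ C) (hb : G.Adj b v) : Reach G C x b false
  | bounce {v b : V} (h : Reach G C x v true) (hv : ∃ d ∈ C, G.IsDescendantOrSelf v d)
      (hb : G.Adj b v) : Reach G C x b false

/-- The `k`-th of the vertices `f 0, …, f n` is a collider of this sequence. -/
def SeqCollider (G : FinDAG V) (f : ℕ → V) (n k : ℕ) : Prop :=
  0 < k ∧ k < n ∧ G.Adj (f (k - 1)) (f k) ∧ G.Adj (f (k + 1)) (f k)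

/-- The sequence `f 0, …, f n` is a walk that is not blocked by `C`. -/
structure ActiveSeq (G : FinDAG V) (C : Set V) (f : ℕ → V) (n : ℕ) : Prop where
  adj : ∀ k < n, G.Adj (f k) (f (k + 1)) ∨ G.Adj (f (k + 1)) (f k)
  collider : ∀ k, G.SeqCollider f n k → ∃ d ∈ C, G.IsDescendantOrSelf (f k) d
  notMem : ∀ k ≤ n, ¬ G.SeqCollider f n k → f k ∉ C

/-! ### Active walks and unblocked paths -/

theorem adj_asymm (G : FinDAG V) {a b : V} (h : G.Adj a b) : ¬ G.Adj b a :=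
  fun h' => G.acyclic a ((Relation.TransGen.single h).tail h')

theorem adj_ne (G : FinDAG V) {a b : V} (h : G.Adj a b) : a ≠ b := by
  rintro rfl
  exact G.acyclic a (.single h)

/-- The walk leaves `f i` downwards but its edge after `f j` points back into `f j`, so it must turn
at a collider, at `f j` at the latest. The first such collider is a descendant of `f i`, and
activity gives it a descendant in `C`. -/
theorem ActiveSeq.exists_descendant {G : FinDAG V} {C : Set V} {f : ℕ → V} {n : ℕ}
    (h : G.ActiveSeq C f n) {j : ℕ} (hj : j < n) (hjd : G.Adj (f (j + 1)) (f j)) (m : ℕ) :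
    ∀ i, i + m + 1 = j → G.Adj (f i) (f (i + 1)) →
      ∃ d ∈ C, G.IsDescendantOrSelf (f i) d := by
  induction m with
  | zero =>
    rintro i rfl hi
    obtain ⟨d, hd, hd'⟩ := h.collider (i + 1) ⟨by omega, hj, hi, hjd⟩
    exact ⟨d, hd, .head hi hd'⟩
  | succ m ih =>
    rintro i hij hi
    have : ∃ d ∈ C, G.IsDescendantOrSelf (f (i + 1)) d := by
      rcases h.adj (i + 1) (by omega) with h' | h'
      · exact ih (i + 1) (by omega) h'
      · exact h.collider (i + 1) ⟨by omega, by omega, hi, h'⟩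
    obtain ⟨d, hd, hd'⟩ := this
    exact ⟨d, hd, .head hi hd'⟩

/-- Cutting out the loop between two visits of a vertex keeps the walk active. Only the junction can
change its collider status. -/
theorem ActiveSeq.splice {G : FinDAG V} {C : Set V} {f : ℕ → V} {i e m : ℕ}
    (h : G.ActiveSeq C f (i + e + m)) (he : 0 < e) (hf : f i = f (i + e)) :
    G.ActiveSeq C (fun k => if k ≤ i then f k else f (k + e)) (i + m) := by
  set g : ℕ → V := fun k => if k ≤ i then f k else f (k + e) with hg
  have gl : ∀ k ≤ i, g k = f k := fun k hk => if_pos hk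
  have gr : ∀ k, i ≤ k → g k = f (k + e) := by
    intro k hk
    rcases hk.eq_or_lt with rfl | hk
    · rw [gl _ le_rfl, hf]
    · exact if_neg (by omega)
  have cl : ∀ k < i, G.SeqCollider g (i + m) k ↔ G.SeqCollider f (i + e + m) k := by
    intro k hk
    unfold SeqCollider
    rw [gl _ (by omega : k - 1 ≤ i), gl _ hk.le, gl _ (by omega : k + 1 ≤ i)]
    have h1 : k < i + m := by omega
    have h2 : k < i + e + m := by omega
    simp [h1, h2]
  have cr : ∀ k, i < k → (G.SeqCollider g (i + m) k ↔ G.SeqCollider f (i + e + m) (k + e)) := by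
    intro k hk
    unfold SeqCollider
    rw [gr _ (by omega : i ≤ k - 1), gr _ hk.le, gr _ (by omega : i ≤ k + 1),
      (by omega : k - 1 + e = k + e - 1), (by omega : k + 1 + e = k + e + 1),
      (by omega : k < i + m ↔ k + e < i + e + m)]
    have h1 : 0 < k := by omega
    have h2 : 0 < k + e := by omega
    simp [h1, h2]
  refine ⟨fun k hk => ?_, fun k hk => ?_, fun k hk hc => ?_⟩
  · rcases lt_or_ge k i with hki | hki
    · rw [gl _ hki.le, gl _ hki]
      exact h.adj k (by omega)
    · rw [gr _ hki, gr _ (by omega), (by omega : k + 1 + e = k + e + 1)]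
      exact h.adj (k + e) (by omega)
  · rcases lt_trichotomy k i with hki | rfl | hki
    · rw [gl _ hki.le]
      exact h.collider k ((cl k hki).1 hk)
    · obtain ⟨h0, hlt, h1, h2⟩ := hk
      rw [gl _ (by omega), gl _ le_rfl] at h1
      rw [gr _ (by omega), gr _ le_rfl, (by omega : k + 1 + e = k + e + 1)] at h2
      rw [gl _ le_rfl]
      -- The junction is a collider. Either the removed loop left it downwards and so met a collider
      -- below it, or the first visit was already a collider.
      rcases h.adj k (by omega) with h3 | h3
      · exact h.exists_descendant (by omega) h2 (e - 1) k (by omega) h3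
      · exact h.collider k ⟨h0, by omega, h1, h3⟩
    · rw [gr _ hki.le]
      exact h.collider (k + e) ((cr k hki).1 hk)
  · rcases lt_trichotomy k i with hki | rfl | hki
    · rw [gl _ hki.le]
      exact h.notMem k (by omega) (mt (cl k hki).2 hc)
    -- When the junction is not a collider, the two visits were not both colliders, so one of them
    -- shows that the vertex is outside `C`.
    · by_cases h1 : G.SeqCollider f (k + e + m) k
      · rw [gr _ le_rfl]
        refine h.notMem (k + e) (by omega) fun h2 => hc ⟨h1.1, ?_, ?_, ?_⟩
        · have := h2.2.1
          omega
        · rw [gl _ (by omega), gl _ le_rfl]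
          exact h1.2.2.1
        · rw [gr _ (by omega), gr _ le_rfl, (by omega : k + 1 + e = k + e + 1)]
          exact h2.2.2.2
      · rw [gl _ le_rfl]
        exact h.notMem k (by omega) h1
    · rw [gr _ hki.le]
      exact h.notMem (k + e) (by omega) (mt (cr k hki).2 hc)

theorem ActiveSeq.exists_injOn {G : FinDAG V} {C : Set V} {f : ℕ → V} {n : ℕ}
    (h : G.ActiveSeq C f n) :
    ∃ g m, G.ActiveSeq C g m ∧ g 0 = f 0 ∧ g m = f n ∧ Set.InjOn g {k | k ≤ m} := by
  induction n using Nat.strong_induction_on generalizing f with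
  | _ n ih =>
    by_cases hinj : Set.InjOn f {k | k ≤ n}
    · exact ⟨f, n, h, rfl, rfl, hinj⟩
    · have : ∃ i j, i < j ∧ j ≤ n ∧ f i = f j := by
        simp only [Set.InjOn, Set.mem_ofPred_eq, not_forall] at hinj
        obtain ⟨i, hi, j, hj, hij, hne⟩ := hinj
        rcases lt_or_gt_of_ne hne with hlt | hlt
        · exact ⟨i, j, hlt, hj, hij⟩
        · exact ⟨j, i, hlt, hi, hij.symm⟩
      obtain ⟨i, j, hij, hj, hf⟩ := this
      obtain ⟨e, rfl⟩ := Nat.exists_eq_add_of_lt hij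
      obtain ⟨m, rfl⟩ := Nat.exists_eq_add_of_le hj
      rw [add_assoc i e 1] at h hf
      obtain ⟨g, m', hg, h0, hm, hi⟩ := ih (i + m) (by omega) (h.splice (by omega) hf)
      refine ⟨g, m', hg, by simpa using h0, ?_, hi⟩
      rw [hm]
      -- For `m = 0` the loop ends the walk, and the spliced sequence ends at `f i` itself.
      rcases Nat.eq_zero_or_pos m with rfl | hm0
      · simpa [add_assoc] using hf
      · rw [if_neg (by omega)]
        congr 1
        omega

theorem exists_walk_getVert {H : SimpleGraph V} (n : ℕ) :
    ∀ f : ℕ → V, (∀ k < n, H.Adj (f k) (f (k + 1))) →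
      ∃ p : H.Walk (f 0) (f n), p.length = n ∧ ∀ k ≤ n, p.getVert k = f k := by
  induction n with
  | zero =>
    intro f _
    exact ⟨.nil, rfl, fun k hk => by simp [Nat.le_zero.1 hk]⟩
  | succ n ih =>
    intro f hf
    obtain ⟨p, hp, hv⟩ := ih (fun k => f (k + 1)) fun k hk => hf (k + 1) (by omega)
    refine ⟨.cons (hf 0 (by omega)) p, by simp [hp], fun k hk => ?_⟩
    cases k with
    | zero => rfl
    | succ k =>
      rw [SimpleGraph.Walk.getVert_cons_succ]
      exact hv k (by omega)

/-- The last vertex is left untested, since its status as a collider depends on how the walk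
continues; the flag retains the direction of the last edge for that purpose. -/
theorem Reach.exists_seq {G : FinDAG V} {C : Set V} {x v : V} {d : Bool} (h : G.Reach C x v d) :
    ∃ (f : ℕ → V) (n : ℕ), f 0 = x ∧ f n = v ∧
      (∀ k < n, G.Adj (f k) (f (k + 1)) ∨ G.Adj (f (k + 1)) (f k)) ∧
      (∀ k < n, G.SeqCollider f n k → ∃ d ∈ C, G.IsDescendantOrSelf (f k) d) ∧
      (∀ k < n, ¬ G.SeqCollider f n k → f k ∉ C) ∧
      (d = true ↔ 0 < n ∧ G.Adj (f (n - 1)) (f n)) := by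
  -- Appending `b` makes `f n` an interior vertex and alters no earlier status. `P` stands for the
  -- flag being `true`.
  have extend : ∀ (f : ℕ → V) (n : ℕ) (b : V) (P : Prop),
      (∀ k < n, G.Adj (f k) (f (k + 1)) ∨ G.Adj (f (k + 1)) (f k)) →
      (∀ k < n, G.SeqCollider f n k → ∃ d ∈ C, G.IsDescendantOrSelf (f k) d) →
      (∀ k < n, ¬ G.SeqCollider f n k → f k ∉ C) →
      (G.Adj (f n) b ∨ G.Adj b (f n)) →
      (P ↔ 0 < n ∧ G.Adj (f (n - 1)) (f n)) →
      (P → G.Adj b (f n) → ∃ d ∈ C, G.IsDescendantOrSelf (f n) d) →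
      (¬ (P ∧ G.Adj b (f n)) → f n ∉ C) →
      ∃ (g : ℕ → V) (m : ℕ), g 0 = f 0 ∧ g m = b ∧
      (∀ k < m, G.Adj (g k) (g (k + 1)) ∨ G.Adj (g (k + 1)) (g k)) ∧
      (∀ k < m, G.SeqCollider g m k → ∃ d ∈ C, G.IsDescendantOrSelf (g k) d) ∧
      (∀ k < m, ¬ G.SeqCollider g m k → g k ∉ C) ∧
      (G.Adj (f n) b ↔ 0 < m ∧ G.Adj (g (m - 1)) (g m)) := by
    intro f n b P h1 h2 h3 hb hP h4 h5
    set g : ℕ → V := fun k => if k ≤ n then f k else b with hg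
    have gl : ∀ k ≤ n, g k = f k := fun k hk => if_pos hk
    have gr : g (n + 1) = b := if_neg (by omega)
    have cl : ∀ k < n, G.SeqCollider g (n + 1) k ↔ G.SeqCollider f n k := by
      intro k hk
      unfold SeqCollider
      rw [gl _ (by omega : k - 1 ≤ n), gl _ hk.le, gl _ (by omega : k + 1 ≤ n)]
      have h1 : k < n + 1 := by omega
      simp [h1, hk]
    have cn : G.SeqCollider g (n + 1) n ↔ P ∧ G.Adj b (f n) := by
      unfold SeqCollider
      rw [gl _ (by omega : n - 1 ≤ n), gl _ le_rfl, gr, hP]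
      simp [and_assoc]
    refine ⟨g, n + 1, gl _ (by omega), gr, fun k hk => ?_, fun k hk hc => ?_, fun k hk hc => ?_, ?_⟩
    · rcases Nat.lt_succ_iff_lt_or_eq.1 hk with hk | rfl
      · rw [gl _ hk.le, gl _ hk]
        exact h1 k hk
      · rwa [gl _ le_rfl, gr]
    · rcases Nat.lt_succ_iff_lt_or_eq.1 hk with hk | rfl
      · rw [gl _ hk.le]
        exact h2 k hk ((cl k hk).1 hc)
      · rw [gl _ le_rfl]
        exact h4 (cn.1 hc).1 (cn.1 hc).2
    · rcases Nat.lt_succ_iff_lt_or_eq.1 hk with hk | rfl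
      · rw [gl _ hk.le]
        exact h3 k hk (mt (cl k hk).2 hc)
      · rw [gl _ le_rfl]
        exact h5 (mt cn.2 hc)
    · rw [gr, Nat.add_sub_cancel, gl _ le_rfl]
      simp
  induction h with
  | start => exact ⟨fun _ => x, 0, by simp⟩
  | @down v b d _ hv hb ih =>
    obtain ⟨f, n, rfl, rfl, h1, h2, h3, h4⟩ := ih
    obtain ⟨g, m, e0, e1, g1, g2, g3, g4⟩ := extend f n b _ h1 h2 h3 (.inl hb) h4
      (fun _ h => absurd h (G.adj_asymm hb)) (fun _ => hv)
    exact ⟨g, m, e0, e1, g1, g2, g3, by rw [← g4]; simpa using hb⟩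
  | @up v b _ hv hb ih =>
    obtain ⟨f, n, rfl, rfl, h1, h2, h3, h4⟩ := ih
    obtain ⟨g, m, e0, e1, g1, g2, g3, g4⟩ := extend f n b _ h1 h2 h3 (.inr hb) h4
      (by simp) (fun _ => hv)
    exact ⟨g, m, e0, e1, g1, g2, g3, by rw [← g4]; simpa using G.adj_asymm hb⟩
  | @bounce v b _ hv hb ih =>
    obtain ⟨f, n, rfl, rfl, h1, h2, h3, h4⟩ := ih
    obtain ⟨g, m, e0, e1, g1, g2, g3, g4⟩ := extend f n b _ h1 h2 h3 (.inr hb) h4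
      (fun _ _ => hv) (fun h => absurd ⟨rfl, hb⟩ h)
    exact ⟨g, m, e0, e1, g1, g2, g3, by rw [← g4]; simpa using G.adj_asymm hb⟩

theorem Reach.exists_path {G : FinDAG V} {C : Set V} {x y : V} {d : Bool} (h : G.Reach C x y d)
    (hy : y ∉ C) : ∃ p : G.skeleton.Walk x y, p.IsPath ∧ ¬ G.IsBlocked C p := by
  obtain ⟨f, n, rfl, rfl, h1, h2, h3, -⟩ := h.exists_seq
  have hf : G.ActiveSeq C f n := by
    refine ⟨h1, fun k hk => h2 k hk.2.1 hk, fun k hk hc => ?_⟩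
    rcases hk.eq_or_lt with rfl | hk
    · exact hy
    · exact h3 k hk hc
  obtain ⟨g, m, hg, e0, em, hinj⟩ := hf.exists_injOn
  rw [← e0, ← em]
  obtain ⟨p, hp, hv⟩ := exists_walk_getVert (H := G.skeleton) m g hg.adj
  have hcol : ∀ k ≤ m, G.IsCollider p k ↔ G.SeqCollider g m k := by
    intro k hk
    unfold IsCollider SeqCollider
    rw [hp]
    refine and_congr_right fun h0 => and_congr_right fun hlt => ?_
    rw [hv _ hk, hv _ (by omega), hv _ (by omega)]
  refine ⟨p, ?_, ?_⟩
  · rw [← SimpleGraph.Walk.IsPath.getVert_injOn_iff, hp]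
    intro a ha b hb hab
    rw [hv a ha, hv b hb] at hab
    exact hinj ha hb hab
  · rintro ⟨i, hi, ⟨hc, hd⟩ | ⟨hc, hd⟩⟩ <;> rw [hp] at hi
    · obtain ⟨d, hdC, hdd⟩ := hg.collider i ((hcol i hi).1 hc)
      rw [← hv i hi] at hdd
      exact hd d hdd hdC
    · rw [hv i hi] at hd
      exact hg.notMem i hi (mt (hcol i hi).2 hc) hd

theorem exists_reach_of_not_isBlocked {G : FinDAG V} {C : Set V} {x y : V}
    {p : G.skeleton.Walk x y} (hp : ¬ G.IsBlocked C p) : y ∉ C ∧ ∃ d, G.Reach C x y d := by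
  have hc : ∀ i ≤ p.length, G.IsCollider p i →
      ∃ d ∈ C, G.IsDescendantOrSelf (p.getVert i) d := by
    intro i hi hc
    by_contra! h
    exact hp ⟨i, hi, .inl ⟨hc, fun d hd hdC => h d hdC hd⟩⟩
  have hn : ∀ i ≤ p.length, ¬ G.IsCollider p i → p.getVert i ∉ C :=
    fun i hi hc h => hp ⟨i, hi, .inr ⟨hc, h⟩⟩
  have key : ∀ i ≤ p.length, ∃ d, G.Reach C x (p.getVert i) d ∧
      (d = true ↔ 0 < i ∧ G.Adj (p.getVert (i - 1)) (p.getVert i)) := by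
    intro i
    induction i with
    | zero => exact fun _ => ⟨false, by simpa using .start, by simp⟩
    | succ i ih =>
      intro hi
      obtain ⟨d, hd, hdi⟩ := ih (by omega)
      rcases (p.adj_getVert_succ (by omega) : G.skeleton.Adj _ (p.getVert (i + 1))) with h | h
      · exact ⟨true, .down hd (hn i (by omega) fun h' => G.adj_asymm h h'.2.2.2) h, by simpa using h⟩
      · refine ⟨false, ?_, by simpa using G.adj_asymm h⟩
        cases d with
        | true =>
          obtain ⟨h0, h1⟩ := hdi.1 rfl
          exact .bounce hd (hc i (by omega) ⟨h0, by omega, h1, h⟩) h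
        | false =>
          refine .up hd (hn i (by omega) fun h' => ?_) h
          simpa using hdi.2 ⟨h'.1, h'.2.2.1⟩
  refine ⟨?_, ?_⟩
  · have := hn p.length le_rfl fun h => absurd h.2.1 (lt_irrefl _)
    rwa [SimpleGraph.Walk.getVert_length] at this
  · obtain ⟨d, hd, -⟩ := key p.length le_rfl
    rw [SimpleGraph.Walk.getVert_length] at hd
    exact ⟨d, hd⟩

/-- The condition `y ∉ C` is separate because `Reach` tests a vertex only when the walk leaves it.
-/
theorem isdSep_iff (G : FinDAG V) (X Y C : Set V) :
    G.IsdSep X Y C ↔ ∀ x ∈ X, ∀ y ∈ Y, y ∉ C → ∀ d, ¬ G.Reach C x y d := by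
  constructor
  · intro h x hx y hy hyC d hd
    obtain ⟨p, hp, hb⟩ := hd.exists_path hyC
    exact hb (h x hx y hy p hp)
  · intro h x hx y hy p _
    by_contra hb
    obtain ⟨hyC, d, hd⟩ := exists_reach_of_not_isBlocked hb
    exact h x hx y hy hyC d hd

/-! ### Active walks under elimination of one vertex -/

theorem elim_adj_of_adj {G : FinDAG V} {w a b : V} (ha : a ≠ w) (hb : b ≠ w) (h : G.Adj a b) :
    (G.elim w).Adj a b :=
  ⟨ha, hb, .inl h⟩

theorem elim_adj_of_adj_adj {G : FinDAG V} {w a b : V} (ha : G.Adj a w) (hb : G.Adj w b) :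
    (G.elim w).Adj a b :=
  ⟨G.adj_ne ha, (G.adj_ne hb).symm, .inr ⟨ha, hb⟩⟩

theorem IsDescendantOrSelf.of_elim {G : FinDAG V} {w a d : V}
    (h : (G.elim w).IsDescendantOrSelf a d) : G.IsDescendantOrSelf a d := by
  unfold IsDescendantOrSelf at h
  induction h with
  | refl => exact .refl
  | tail _ hbc ih =>
    obtain ⟨-, -, h | ⟨h1, h2⟩⟩ := hbc
    · exact .tail ih h
    · exact .tail (.tail ih h1) h2

/-- The clause for `d = w` keeps the induction going: a directed path stopping at `w` is remembered
by the parent through which it arrived, from which a new edge leads to the next vertex. -/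
theorem IsDescendantOrSelf.elim {G : FinDAG V} {w a d : V} (h : G.IsDescendantOrSelf a d)
    (ha : a ≠ w) :
    (d ≠ w → (G.elim w).IsDescendantOrSelf a d) ∧
      (d = w → ∃ p, G.Adj p w ∧ (G.elim w).IsDescendantOrSelf a p) := by
  unfold IsDescendantOrSelf at h
  induction h with
  | refl => exact ⟨fun _ => .refl, fun h => absurd h ha⟩
  | @tail b c _ hbc ih =>
    refine ⟨fun hc => ?_, ?_⟩
    · by_cases hb : b = w
      · obtain ⟨p, hp, hap⟩ := ih.2 hb
        subst hb
        exact .tail hap (elim_adj_of_adj_adj hp hbc)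
      · exact .tail (ih.1 hb) (elim_adj_of_adj hb hc hbc)
    · rintro rfl
      exact ⟨b, hbc, ih.1 (G.adj_ne hbc)⟩

/-- If the only witness in `C` is `w`, a parent of `w` on the way to it replaces it. -/
theorem exists_descendant_elim_iff {G : FinDAG V} {C : Set V} {w v : V}
    (hC : w ∈ C → ∀ p, G.Adj p w → p ∈ C) (hv : v ≠ w) :
    (∃ d ∈ C \ {w}, (G.elim w).IsDescendantOrSelf v d) ↔
      ∃ d ∈ C, G.IsDescendantOrSelf v d := by
  constructor
  · rintro ⟨d, hd, h⟩
    exact ⟨d, hd.1, h.of_elim⟩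
  · rintro ⟨d, hd, h⟩
    by_cases hdw : d = w
    · obtain ⟨p, hp, hvp⟩ := (h.elim hv).2 hdw
      exact ⟨p, ⟨hC (hdw ▸ hd) p hp, G.adj_ne hp⟩, hvp⟩
    · exact ⟨d, ⟨hd, hdw⟩, (h.elim hv).1 hdw⟩

theorem Reach.ne_of_elim {G : FinDAG V} {C : Set V} {w x v : V} {d : Bool}
    (h : (G.elim w).Reach C x v d) (hx : x ≠ w) : v ≠ w := by
  cases h with
  | start => exact hx
  | down _ _ hb => exact hb.2.1
  | up _ _ hb => exact hb.1
  | bounce _ _ hb => exact hb.1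

/-- A new edge unfolds into two edges through `w`. This fails only upwards with `w ∈ C`; the walk is
then at a parent of `w`, which lies in `C`, with flag `false`, and cannot be continued. -/
theorem Reach.of_elim {G : FinDAG V} {C : Set V} {w x v : V} {d : Bool}
    (hC : w ∈ C → ∀ p, G.Adj p w → p ∈ C) (hx : x ≠ w)
    (h : (G.elim w).Reach (C \ {w}) x v d) : G.Reach C x v d ∨ v ∈ C ∧ d = false := by
  induction h with
  | start => exact .inl .start
  | @down v b d h hv hb ih =>
    have hvC : v ∉ C := fun h' => hv ⟨h', h.ne_of_elim hx⟩
    have hr := ih.resolve_right fun h' => hvC h'.1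
    obtain ⟨-, -, hb | ⟨h1, h2⟩⟩ := hb
    · exact .inl (.down hr hvC hb)
    · exact .inl (.down (.down hr hvC h1) (fun hw => hvC (hC hw v h1)) h2)
  | @up v b h hv hb ih =>
    have hvC : v ∉ C := fun h' => hv ⟨h', h.ne_of_elim hx⟩
    have hr := ih.resolve_right fun h' => hvC h'.1
    obtain ⟨-, -, hb | ⟨h1, h2⟩⟩ := hb
    · exact .inl (.up hr hvC hb)
    · by_cases hw : w ∈ C
      · exact .inr ⟨hC hw b h1, rfl⟩
      · exact .inl (.up (.up hr hvC h2) hw h1)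
  | @bounce v b h hv hb ih =>
    have hr := ih.resolve_right (by simp)
    have hv' := (exists_descendant_elim_iff hC (h.ne_of_elim hx)).1 hv
    obtain ⟨-, -, hb | ⟨h1, h2⟩⟩ := hb
    · exact .inl (.bounce hr hv' hb)
    · by_cases hw : w ∈ C
      · exact .inr ⟨hC hw b h1, rfl⟩
      · exact .inl (.up (.bounce hr hv' h2) hw h1)

/-- Only a child of `w` can lead into `w`, and from there a walk with flag `false` is stuck. -/
theorem Reach.elim_of_mem {G : FinDAG V} {C : Set V} {w x v : V} {d : Bool}
    (hw : w ∈ C) (hC : ∀ p, G.Adj p w → p ∈ C) (hx : x ≠ w) (h : G.Reach C x v d) :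
    (v ≠ w ∧ (G.elim w).Reach (C \ {w}) x v d) ∨ v = w ∧ d = false := by
  induction h with
  | start => exact .inl ⟨hx, .start⟩
  | @down v b d h hv hb ih =>
    obtain ⟨hvw, hr⟩ := ih.resolve_right fun h' => hv (h'.1 ▸ hw)
    have hbw : b ≠ w := by
      rintro rfl
      exact hv (hC v hb)
    exact .inl ⟨hbw, .down hr (fun h' => hv h'.1) (elim_adj_of_adj hvw hbw hb)⟩
  | @up v b h hv hb ih =>
    obtain ⟨hvw, hr⟩ := ih.resolve_right fun h' => hv (h'.1 ▸ hw)
    by_cases hbw : b = w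
    · exact .inr ⟨hbw, rfl⟩
    · exact .inl ⟨hbw, .up hr (fun h' => hv h'.1) (elim_adj_of_adj hbw hvw hb)⟩
  | @bounce v b h hv hb ih =>
    obtain ⟨hvw, hr⟩ := ih.resolve_right (by simp)
    by_cases hbw : b = w
    · exact .inr ⟨hbw, rfl⟩
    · exact .inl ⟨hbw, .bounce hr ((exists_descendant_elim_iff (fun _ => hC) hvw).2 hv)
        (elim_adj_of_adj hbw hvw hb)⟩

/-- Since `w` is absent after elimination, an active walk standing at `w` is represented by all the
vertices it may reach in its next step. -/
theorem Reach.elim_of_notMem {G : FinDAG V} {C : Set V} {w x v : V} {d : Bool}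
    (hw : w ∉ C) (hC : ∃ p, G.Adj p w ∧ p ∉ C) (hx : x ≠ w) (h : G.Reach C x v d) :
    (v ≠ w → (G.elim w).Reach (C \ {w}) x v d) ∧
      (v = w → (∀ b, G.Adj w b → (G.elim w).Reach (C \ {w}) x b true) ∧
        ∀ b, G.Adj b w → (d = true → ∃ d ∈ C, G.IsDescendantOrSelf w d) →
          (G.elim w).Reach (C \ {w}) x b false) := by
  have hd : ∀ {v}, v ≠ w → (∃ d ∈ C, G.IsDescendantOrSelf v d) →
      ∃ d ∈ C \ {w}, (G.elim w).IsDescendantOrSelf v d :=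
    fun hv => (exists_descendant_elim_iff (fun h' => absurd h' hw) hv).2
  have hm : ∀ {v}, v ∉ C → v ∉ C \ {w} := fun hv h' => hv h'.1
  obtain ⟨p, hpw, hpC⟩ := hC
  induction h with
  | start => exact ⟨fun _ => .start, fun h => absurd h hx⟩
  | @down v b d h hv hb ih =>
    by_cases hvw : v = w
    · subst hvw
      exact ⟨fun _ => (ih.2 rfl).1 b hb, fun h => absurd h.symm (G.adj_ne hb)⟩
    · have hr := ih.1 hvw
      refine ⟨fun hbw => .down hr (hm hv) (elim_adj_of_adj hvw hbw hb), ?_⟩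
      rintro rfl
      refine ⟨fun c hc => .down hr (hm hv) (elim_adj_of_adj_adj hb hc), fun c hc hdesc => ?_⟩
      obtain ⟨z, hz, hbz⟩ := hdesc rfl
      -- As `w ∉ C`, the descendant in `C` lies below some child `e` of `w`, and the collider is
      -- moved to `e`.
      rcases Relation.ReflTransGen.cases_head hbz with rfl | ⟨e, he, hez⟩
      · exact absurd hz hw
      · exact .bounce (.down hr (hm hv) (elim_adj_of_adj_adj hb he))
          (hd (G.adj_ne he).symm ⟨z, hz, hez⟩) (elim_adj_of_adj_adj hc he)
  | @up v b h hv hb ih =>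
    by_cases hvw : v = w
    · subst hvw
      exact ⟨fun _ => (ih.2 rfl).2 b hb (by simp), fun h => absurd h (G.adj_ne hb)⟩
    · have hr := ih.1 hvw
      refine ⟨fun hbw => .up hr (hm hv) (elim_adj_of_adj hbw hvw hb), ?_⟩
      rintro rfl
      -- The fork at `w` is replaced by a fork at its parent `p ∉ C`.
      exact ⟨fun c hc => .down (.up hr (hm hv) (elim_adj_of_adj_adj hpw hb)) (hm hpC)
        (elim_adj_of_adj_adj hpw hc), fun c hc _ => .up hr (hm hv) (elim_adj_of_adj_adj hc hb)⟩
  | @bounce v b h hv hb ih =>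
    by_cases hvw : v = w
    · subst hvw
      exact ⟨fun _ => (ih.2 rfl).2 b hb fun _ => hv, fun h => absurd h (G.adj_ne hb)⟩
    · have hr := ih.1 hvw
      refine ⟨fun hbw => .bounce hr (hd hvw hv) (elim_adj_of_adj hbw hvw hb), ?_⟩
      rintro rfl
      exact ⟨fun c hc => .down (.bounce hr (hd hvw hv) (elim_adj_of_adj_adj hpw hb)) (hm hpC)
        (elim_adj_of_adj_adj hpw hc),
        fun c hc _ => .bounce hr (hd hvw hv) (elim_adj_of_adj_adj hc hb)⟩

/-- Both directions of `hC` are used: one puts the parents in `C` when `w ∈ C`, the other supplies a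
parent outside `C` when `w ∉ C`. A parentless `w` is thereby in `C`. -/
theorem isdSep_elim_iff {G : FinDAG V} {C X Y : Set V} {w : V}
    (hC : w ∈ C ↔ ∀ p, G.Adj p w → p ∈ C) (hX : w ∉ X) (hY : w ∉ Y) :
    G.IsdSep X Y C ↔ (G.elim w).IsdSep X Y (C \ {w}) := by
  rw [isdSep_iff, isdSep_iff]
  refine forall₄_congr fun x hx y hy => ?_
  have hxw : x ≠ w := fun h => hX (h ▸ hx)
  have hyw : y ≠ w := fun h => hY (h ▸ hy)
  have hyC : y ∉ C \ {w} ↔ y ∉ C := by simp [hyw]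
  rw [hyC]
  refine forall₂_congr fun hy' d => not_congr ⟨fun h => ?_, fun h => ?_⟩
  · by_cases hw : w ∈ C
    · exact ((h.elim_of_mem hw (hC.1 hw) hxw).resolve_right fun h' => hyw h'.1).2
    · refine (h.elim_of_notMem hw ?_ hxw).1 hyw
      by_contra! hcon
      exact hw (hC.2 hcon)
  · exact (h.of_elim hC.1 hxw).resolve_right fun h' => hy' h'.1

/-! ### The functional closure under elimination -/

theorem FunClosure.iff_parents {G : FinDAG V} {W Z : Set V} {w : V} (hw : w ∈ W) (hZ : w ∉ Z) :
    G.FunClosure W Z w ↔ ∀ p, G.Adj p w → G.FunClosure W Z p := by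
  refine ⟨fun h => ?_, .step hw⟩
  cases h with
  | base hv => exact absurd hv hZ
  | step _ hp => exact hp

theorem funClosure_elim {G : FinDAG V} {W Z : Set V} {w : V} (hw : w ∈ W) (hZ : w ∉ Z) :
    {v | (G.elim w).FunClosure (W \ {w}) Z v} = {v | G.FunClosure W Z v} \ {w} := by
  ext v
  constructor
  · intro h
    change (G.elim w).FunClosure (W \ {w}) Z v at h
    induction h with
    | base hv => exact ⟨FunClosure.base hv, fun h => hZ (h ▸ hv)⟩
    | @step v hv _ ih =>
      refine ⟨FunClosure.step hv.1 fun u hu => ?_, hv.2⟩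
      -- If `w` is a parent of `v`, its parents become parents of `v`, so they are already in the
      -- closure and force `w` into it.
      by_cases huw : u = w
      · subst huw
        exact .step hw fun p hp => (ih p (elim_adj_of_adj_adj hp hu)).1
      · exact (ih u (elim_adj_of_adj huw hv.2 hu)).1
  · rintro ⟨h, hvw⟩
    -- Membership of `w` survives elimination as membership of all its parents.
    have key : (v ≠ w → (G.elim w).FunClosure (W \ {w}) Z v) ∧
        (v = w → ∀ p, G.Adj p w → (G.elim w).FunClosure (W \ {w}) Z p) := by
      clear hvw
      change G.FunClosure W Z v at h
      induction h with
      | base hv => exact ⟨fun _ => .base hv, fun h => absurd (h ▸ hv) hZ⟩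
      | @step v hv _ ih =>
        refine ⟨fun hvw => .step ⟨hv, hvw⟩ fun u hu => ?_, ?_⟩
        · obtain ⟨huw, -, h | ⟨h1, h2⟩⟩ := hu
          · exact (ih u h).1 huw
          · exact (ih w h2).2 rfl u h1
        · rintro rfl p hp
          exact (ih p hp).1 (G.adj_ne hp)
    exact key.1 hvw

theorem isDSepFunctional_elim_iff {G : FinDAG V} {W X Y Z : Set V} {w : V} (hw : w ∈ W)
    (hX : w ∉ X) (hY : w ∉ Y) (hZ : w ∉ Z) :
    G.IsDSepFunctional W X Y Z ↔ (G.elim w).IsDSepFunctional (W \ {w}) X Y Z := by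
  unfold IsDSepFunctional
  rw [funClosure_elim hw hZ]
  exact isdSep_elim_iff (FunClosure.iff_parents hw hZ) hX hY

/-! ### Iterated elimination -/

theorem elimList_verts (G : FinDAG V) (l : List V) :
    (G.elimList l).verts = G.verts \ {v | v ∈ l} := by
  induction l generalizing G with
  | nil => simp [elimList]
  | cons w l ih =>
    change ((G.elim w).elimList l).verts = _
    rw [ih]
    ext v
    simp [elim, and_assoc]

/-- Distinctness of the entries ensures that each later variable is still designated functional once
the earlier ones are removed from `W`. -/
theorem isDSepFunctional_elimList_iff (l : List V) :
    ∀ {G : FinDAG V} {W X Y Z : Set V}, l.Nodup → (∀ v ∈ l, v ∈ W) → (∀ v ∈ l, v ∉ X) →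
      (∀ v ∈ l, v ∉ Y) → (∀ v ∈ l, v ∉ Z) →
      (G.IsDSepFunctional W X Y Z ↔
        (G.elimList l).IsDSepFunctional (W \ {v | v ∈ l}) X Y Z) := by
  induction l with
  | nil => intros; simp [elimList]
  | cons w l ih =>
    intro G W X Y Z hl hW hX hY hZ
    rw [List.nodup_cons] at hl
    simp only [List.forall_mem_cons] at hW hX hY hZ
    rw [isDSepFunctional_elim_iff hW.1 hX.1 hY.1 hZ.1,
      ih (W := W \ {w}) hl.2 (fun v hv => ⟨hW.2 v hv, fun h => hl.1 (h ▸ hv)⟩) hX.2 hY.2 hZ.2]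
    have : (W \ {w}) \ {v | v ∈ l} = W \ {v | v ∈ w :: l} := by
      ext v
      simp [and_assoc]
    rw [this]
    rfl

end FinDAG

theorem mainTheorem5 {V : Type*} (G : FinDAG V) (W W' : Set V)
    (hW : W ⊆ G.verts) (hW' : W' ⊆ W)
    (l : List V) (hl : l.Nodup) (hlW' : ∀ v, v ∈ l ↔ v ∈ W')
    (X Y Z : Set V)
    (hX : X ⊆ (G.elimList l).verts) (hY : Y ⊆ (G.elimList l).verts)
    (hZ : Z ⊆ (G.elimList l).verts)
    (hXY : Disjoint X Y) (hXZ : Disjoint X Z) (hYZ : Disjoint Y Z) :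
    G.IsDSepFunctional W X Y Z ↔ (G.elimList l).IsDSepFunctional (W \ W') X Y Z := by
  rw [FinDAG.elimList_verts] at hX hY hZ
  have hl' : {v | v ∈ l} = W' := Set.ext hlW'
  have h := FinDAG.isDSepFunctional_elimList_iff l (G := G) (W := W) (X := X) (Y := Y) (Z := Z) hl
    (fun v hv => hW' ((hlW' v).1 hv)) (fun v hv h => (hX h).2 hv) (fun v hv h => (hY h).2 hv)
    (fun v hv h => (hZ h).2 hv)
  rwa [hl'] at h
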